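/- Let $G$ be a countable directed graph (multiple edges and loop edges allowed) with vertex set $V(G)$, and let $\mathbb F^+(G)=V(G)\sqcup FP(G)$ be its free semigroupoid: the vertices (paths of length $0$) and the admissible finite paths of length at least $1$; a path $w$ has source $s(w)$ and range $r(w)$. On $H_G=\ell^2(\mathbb F^+(G))$, with orthonormal basis $(\xi_w)$, let $L_w$ be the creation operator: $L_w\xi_h=\xi_{wh}$ if $wh$ is admissible and $L_w\xi_h=0$ otherwise. Let $W^*(G)\subset B(H_G)$ be the weak operator closure of the $*$-algebra generated by $\{L_w: w\in\mathbb F^+(G)\}$, let $D_G\subset W^*(G)$ be the weak operator closure of the algebra generated by the projections $L_v$, $v\in V(G)$, and let $E(a)=\sum_{v\in V(G)}\langle \xi_v,a\xi_v\rangle L_v$ be the canonical conditional expectation of $W^*(G)$ onto $D_G$. For $a\in W^*(G)$, the coefficients of $L_w$ and $L_w^*$ in the (formal) Fourier expansion of $a$ are $\langle \xi_w,a\,\xi_{r(w)}\rangle$ and $\langle \xi_{r(w)},a\,\xi_w\rangle$; the support $\mathbb F^+(G:a)$ is the set of $w$ for which at least one of them is nonzero. For $v\in V(G)$ let $loop_v(G:a)$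 be the set of loops $l\in FP(G)\cap \mathbb F^+(G:a)$ with $s(l)=r(l)=v$. For a finite set $V\subset V(G)$ let $P_V(a)=\sum_{v\in V}L_v a L_v$ be the diagonal compression. **Proposition.** Let $a\in W^*(G)$ and let $V_1,V_2$ be finite subsets of $V(G)$ with $V_1\cap V_2=\emptyset$ and $loop_{v}(G:a)\cap loop_{v'}(G:a)=\emptyset$ for all $v\in V_1$, $v'\in V_2$. Then $x_1=P_{V_1}(a)$ and $x_2=P_{V_2}(a)$ are free over $D_G$ in $(W^*(G),E)$. That is, with $B_i$ the von Neumann algebra generated by $x_i$ and $D_G$: 1. if $c_j\in B_{i_j}$, $E(c_j)=0$ for $j=1,\dots,n$, $n\ge1$, and $i_j\ne i_{j+1}$ for $1\le j<n$, then $E(c_1c_2\cdots c_n)=0$; 2. all mixed $D_G$-valued cumulants of $x_1,x_2$ and their adjoints vanish: $k_n(d_1x_{i_1}^{\varepsilon_1},\dots,d_nx_{i_n}^{\varepsilon_n})=0$ for all $n$, all $d_1,\dots,d_n\in D_G$, all $\varepsilon_j\in\{1,*\}$ and all $i_1,\dots,i_n\in\{1,2\}$ that are not all equal, where $k_n(a_1,\dots,a_n)=\sum_{\pi\in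 NC(n)}\mu(\pi,1_n)\,\widehat E(\pi)(a_1\otimes\cdots\otimes a_n)$, the sum being over noncrossing partitions, $\mu$ the Möbius function of the lattice $NC(n)$, and $\widehat E(\pi)$ the nested moment of $\pi$; 3. neither of $x_1,x_2$ lies in the von Neumann algebra generated by the other one and $D_G$, unless it lies in $D_G$. -/

import Mathlib

open scoped ComplexInnerProductSpace ENNReal

noncomputable section

namespace GraphW

/-! ### Operator-valued free probability: noncrossing partitions, cumulants, freeness -/

section FreeProbability

/-- A partition of `{0, …, n-1}`, given by its equivalence relation, is noncrossing if
`i < j < k < l`, `i ∼ k` and `j ∼ l` imply `i ∼ j`. -/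
def IsNoncrossing {n : ℕ} (r : Setoid (Fin n)) : Prop :=
  ∀ i j k l : Fin n, i < j → j < k → k < l → r i k → r j l → r i j

/-- The poset `NC(n)` of noncrossing partitions, ordered by refinement (`π ≤ ρ` if every block of
`π` lies in a block of `ρ`). -/
abbrev NC (n : ℕ) : Type := {r : Setoid (Fin n) // IsNoncrossing r}

/-- The one-block partition `1_n`. -/
def NC.one (n : ℕ) : NC n := ⟨⊤, fun _ _ _ _ _ _ _ _ _ => trivial⟩

instance (n : ℕ) : Finite (Setoid (Fin n)) :=
  Finite.of_injective (fun r : Setoid (Fin n) => fun i j => r i j)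
    (fun _ _ h => Setoid.ext fun i j => iff_of_eq (congrFun (congrFun h i) j))

instance (n : ℕ) : Fintype (NC n) := Fintype.ofFinite _

instance (n : ℕ) : LocallyFiniteOrder (NC n) := by
  classical exact Fintype.toLocallyFiniteOrder

variable {A : Type*} [Ring A]

open Classical in
/-- Auxiliary function for `momentNC`: evaluates the nested moment of the entries `a i`, `i` in
the list, the first entry being preceded in its block by the accumulated product `acc`.
With `i` the first element of the list, the elements of the list before the next element `k` of
the block of `i` form a gap, whose nested moment is evaluated and inserted between `a i` and `a k`;
when the block of `i` is exhausted, `E` is applied to the accumulated product. -/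
def nestedMoment (E : A → A) {n : ℕ} (r : Setoid (Fin n)) (a : Fin n → A) :
    A → List (Fin n) → A
  | _, [] => 1
  | acc, i :: t =>
    if t.dropWhile (fun j => decide (¬ r i j)) = [] then
      E (acc * a i) * nestedMoment E r a 1 t
    else
      nestedMoment E r a
        (acc * a i * nestedMoment E r a 1 (t.takeWhile (fun j => decide (¬ r i j))))
        (t.dropWhile (fun j => decide (¬ r i j)))
  termination_by _ l => l.length
  decreasing_by
    · simp
    · exact Nat.lt_succ_of_le (List.takeWhile_sublist _).length_le
    · exact Nat.lt_succ_of_le (List.dropWhile_sublist _).length_le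

/-- The partition-dependent moment `Ê(π)(a₁ ⊗ ⋯ ⊗ aₙ)`: `E` is applied blockwise following the
nesting of the blocks, e.g. `E (a₁ E (a₂) a₃) E (a₄)` for `π = {{1, 3}, {2}, {4}}`. -/
def momentNC (E : A → A) {n : ℕ} (π : NC n) (a : Fin n → A) : A :=
  nestedMoment E π.1 a 1 (List.finRange n)

open Classical in
/-- The operator-valued cumulant `kₙ(a₁, …, aₙ) = ∑_{π ∈ NC(n)} μ(π, 1ₙ) Ê(π)(a₁ ⊗ ⋯ ⊗ aₙ)`,
with `μ` the Möbius function of the poset `NC(n)`. -/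
def cumulant (E : A → A) {n : ℕ} (a : Fin n → A) : A :=
  ∑ π : NC n, IncidenceAlgebra.mu ℤ π (NC.one n) • momentNC E π a

/-- Freeness of two algebras `B 0`, `B 1` (containing the range of the conditional expectation `E`)
with amalgamation: an alternating product of centred elements is centred. -/
def FreeAlgebras (E : A → A) (B : Fin 2 → Set A) : Prop :=
  ∀ (n : ℕ) (i : Fin (n + 1) → Fin 2) (c : Fin (n + 1) → A),
    (∀ j : Fin n, i j.castSucc ≠ i j.succ) →
    (∀ j, c j ∈ B (i j) ∧ E (c j) = 0) →
    E (List.ofFn c).prod = 0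

/-- All mixed cumulants, with coefficients in `D`, of the variables `x 0`, `x 1` and their adjoints
vanish: `kₙ(d₁ x_{i₁}^{ε₁}, …, dₙ x_{iₙ}^{εₙ}) = 0` unless `i₁ = ⋯ = iₙ`. -/
def MixedCumulantsVanish [Star A] (E : A → A) (D : Set A) (x : Fin 2 → A) : Prop :=
  ∀ (n : ℕ) (i : Fin n → Fin 2) (ε : Fin n → Bool) (d : Fin n → A),
    (∀ j, d j ∈ D) → (∃ j k, i j ≠ i k) →
    cumulant E (fun j => d j * if ε j then star (x (i j)) else x (i j)) = 0

end FreeProbability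

/-! ### Von Neumann algebra generated by a set of operators -/

/-- The closure in the weak operator topology of the unital `*`-algebra generated by `S`. -/
def vonNeumann {H : Type*} [NormedAddCommGroup H] [InnerProductSpace ℂ H] [CompleteSpace H]
    (S : Set (H →L[ℂ] H)) : Set (H →L[ℂ] H) :=
  {T | ContinuousLinearMapWOT.ofCLM T ∈
    closure (ContinuousLinearMapWOT.ofCLM '' (StarAlgebra.adjoin ℂ S : Set (H →L[ℂ] H)))}

/-! ### The free semigroupoid and the operators on the graph Hilbert space -/

universe u v

/-- The free semigroupoid `𝔽⁺(G)` of a directed graph: all vertices (paths of length `0`) and all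
admissible finite paths, with source `src` and range `rng`. -/
@[ext]
structure FreeSemigroupoid (V : Type u) [Quiver.{v} V] where
  src : V
  rng : V
  path : Quiver.Path src rng

variable {V : Type u} [Quiver.{v} V]

namespace FreeSemigroupoid

/-- A vertex as an element of the free semigroupoid. -/
def vertex (x : V) : FreeSemigroupoid V := ⟨x, x, .nil⟩

/-- The set `FP(G)` of finite paths, of length at least `1`. -/
def FP (V : Type u) [Quiver.{v} V] : Set (FreeSemigroupoid V) := {w | 1 ≤ w.path.length}

open Classical in
/-- The partial product `w h` (first `w`, then `h`), defined when `h` starts where `w` ends. -/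
def mul? (w h : FreeSemigroupoid V) : Option (FreeSemigroupoid V) :=
  if e : h.src = w.rng then some ⟨w.src, h.rng, w.path.comp (h.path.cast e rfl)⟩ else none

theorem mul?_inj (w h h' u : FreeSemigroupoid V) (h1 : mul? w h = some u)
    (h2 : mul? w h' = some u) : h = h' := by
  obtain ⟨x, y, p⟩ := w
  obtain ⟨a, b, q⟩ := h
  obtain ⟨a', b', q'⟩ := h'
  unfold mul? at h1 h2
  split_ifs at h1 h2 with e e'
  dsimp only at e e'
  subst e e'
  rw [← h1] at h2
  simp only [Option.some.injEq, FreeSemigroupoid.mk.injEq, true_and] at h2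
  obtain ⟨rfl, h2⟩ := h2
  simpa using h2.symm

end FreeSemigroupoid

open FreeSemigroupoid

/-- The graph Hilbert space `H_G = ℓ²(𝔽⁺(G))`. -/
abbrev GraphHilbert (V : Type u) [Quiver.{v} V] : Type max u v :=
  lp (fun _ : FreeSemigroupoid V => ℂ) 2

open Classical in
/-- The basis vector `ξ_w`. -/
def basisVec (w : FreeSemigroupoid V) : GraphHilbert V := lp.single 2 w 1

section WeightedComposition

variable {ι : Type*}

theorem sum_option_le (φ : ι → Option ι) (hφ : ∀ h h' u, φ h = some u → φ h' = some u → h = h')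
    (c : ι → ℂ) (C : ℝ) (hc : ∀ i, ‖c i‖ ≤ C) (f : lp (fun _ : ι => ℂ) 2) (s : Finset ι) :
    ∑ i ∈ s, ‖c i * (φ i).elim 0 f‖ ^ (2 : ℝ≥0∞).toReal ≤ (C ^ 2) * ‖f‖ ^ 2 := by
  classical
  have h2 : (2 : ℝ≥0∞).toReal = ((2 : ℕ) : ℝ) := by simp
  simp only [h2, Real.rpow_natCast]
  let g : Option ι → ℝ := fun o => ‖(o.elim 0 f : ℂ)‖ ^ 2
  have step1 : ∑ i ∈ s, ‖c i * (φ i).elim 0 f‖ ^ 2 ≤ C ^ 2 * ∑ i ∈ s, g (φ i) := by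
    rw [Finset.mul_sum]
    refine Finset.sum_le_sum fun i _ => ?_
    rw [norm_mul, mul_pow]
    exact mul_le_mul_of_nonneg_right (pow_le_pow_left₀ (norm_nonneg _) (hc i) 2) (by positivity)
  refine step1.trans (mul_le_mul_of_nonneg_left ?_ (by positivity))
  have e1 : ∑ i ∈ s, g (φ i) = ∑ i ∈ s.filter (fun i => φ i ≠ none), g (φ i) := by
    refine (Finset.sum_filter_of_ne fun i _ hi => ?_).symm
    rintro hn
    exact hi (by simp [g, hn])
  have e2 : ∑ i ∈ s.filter (fun i => φ i ≠ none), g (φ i)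
      = ∑ o ∈ (s.filter (fun i => φ i ≠ none)).image φ, g o := by
    refine (Finset.sum_image fun i hi j hj hij => ?_).symm
    obtain ⟨u, hu⟩ := Option.ne_none_iff_exists'.1 (Finset.mem_filter.1 hi).2
    exact hφ i j u hu (hij ▸ hu)
  set t := (s.filter (fun i => φ i ≠ none)).image φ
  have e3 : ∑ o ∈ t, g o ≤ ∑ o ∈ Finset.insertNone (Finset.eraseNone t), g o :=
    Finset.sum_le_sum_of_subset_of_nonneg
      (fun o ho => by cases o <;> simp_all) (fun _ _ _ => by positivity)
  rw [e1, e2]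
  refine e3.trans ?_
  rw [Finset.sum_insertNone]
  have := lp.sum_rpow_le_norm_rpow (p := 2) (by simp) f (Finset.eraseNone t)
  simp only [h2, Real.rpow_natCast] at this
  simpa [g] using this

/-- For a partially injective `φ` and bounded weights `c`, the bounded operator
`(T f)(i) = c(i) f(φ(i))` on `ℓ²`, with value `0` where `φ(i)` is undefined. -/
def weightedComp (φ : ι → Option ι) (hφ : ∀ h h' u, φ h = some u → φ h' = some u → h = h')
    (c : ι → ℂ) (C : ℝ) (hc : ∀ i, ‖c i‖ ≤ C) :
    lp (fun _ : ι => ℂ) 2 →L[ℂ] lp (fun _ : ι => ℂ) 2 :=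
  LinearMap.mkContinuous
    { toFun := fun f => ⟨fun i => c i * (φ i).elim 0 f,
        memℓp_gen' (sum_option_le φ hφ c C hc f)⟩
      map_add' := fun f g => by
        ext i
        change c i * (φ i).elim 0 ((f + g : lp (fun _ : ι => ℂ) 2) : ι → ℂ)
          = c i * (φ i).elim 0 f + c i * (φ i).elim 0 g
        rcases φ i with _ | j
        · change c i * 0 = c i * 0 + c i * 0
          simp
        · exact mul_add _ _ _
      map_smul' := fun a f => by
        ext i
        change c i * (φ i).elim 0 ((a • f : lp (fun _ : ι => ℂ) 2) : ι → ℂ)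
          = a * (c i * (φ i).elim 0 f)
        rcases φ i with _ | j
        · change c i * 0 = a * (c i * 0)
          simp
        · exact mul_left_comm _ _ _ }
    |C| fun f => by
      refine lp.norm_le_of_forall_sum_le (by simp) (by positivity) fun s => ?_
      have h2 : (2 : ℝ≥0∞).toReal = ((2 : ℕ) : ℝ) := by simp
      refine (sum_option_le φ hφ c C hc f s).trans_eq ?_
      rw [h2, Real.rpow_natCast, mul_pow, sq_abs]

@[simp]
theorem weightedComp_apply (φ : ι → Option ι) (hφ) (c : ι → ℂ) (C : ℝ) (hc)
    (f : lp (fun _ : ι => ℂ) 2) (i : ι) :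
    weightedComp φ hφ c C hc f i = c i * (φ i).elim 0 f := rfl

end WeightedComposition

/-- The annihilation operator `L_w^*`: `(L_w^* f)(h) = f(w h)` if `w h` is admissible, and `0`
otherwise; so `L_w^* ξ_{wh} = ξ_h`, and `L_w^* ξ_u = 0` if `u` does not begin with `w`. -/
def annihilation (w : FreeSemigroupoid V) : GraphHilbert V →L[ℂ] GraphHilbert V :=
  weightedComp (mul? w) (mul?_inj w) (fun _ => 1) 1 (fun _ => by simp)

/-- The creation operator `L_w`, multiplication by `ξ_w` on the left
(see `creation_basisVec`). -/
def creation (w : FreeSemigroupoid V) : GraphHilbert V →L[ℂ] GraphHilbert V :=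
  ContinuousLinearMap.adjoint (annihilation w)

/-- `L_w ξ_h = ξ_{wh}` if `w h` is admissible, and `L_w ξ_h = 0` otherwise. -/
theorem creation_basisVec (w h : FreeSemigroupoid V) :
    creation w (basisVec h) = (mul? w h).elim 0 basisVec := by
  classical
  ext u
  have e : ∀ f : GraphHilbert V, f u = ⟪basisVec u, f⟫ := fun f => by
    unfold basisVec
    rw [lp.inner_single_left]
    simp
  rw [e, creation, ContinuousLinearMap.adjoint_inner_right]
  unfold basisVec
  rw [lp.inner_single_right]
  simp only [annihilation, weightedComp_apply, one_mul]
  cases mul? w h with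
  | none => simp
  | some x =>
    simp only [Option.elim_some, lp.single_apply, Pi.single_apply]
    by_cases hxu : x = u
    · subst hxu; simp
    · simp [hxu, Ne.symm hxu]

/-! ### The graph `W*`-probability space over the diagonal subalgebra -/

/-- The projection `L_v` of a vertex `v`. -/
abbrev vertexProj (x : V) : GraphHilbert V →L[ℂ] GraphHilbert V := creation (vertex x)

/-- The graph `W*`-algebra `W*(G)`, the weak closure of `ℂ[{L_w, L_w^* : w ∈ 𝔽⁺(G)}]`. -/
def graphAlgebra (V : Type u) [Quiver.{v} V] : Set (GraphHilbert V →L[ℂ] GraphHilbert V) :=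
  vonNeumann (Set.range (creation : FreeSemigroupoid V → _))

/-- The diagonal subalgebra `D_G`, the weak closure of `ℂ[{L_v : v ∈ V(G)}]`. -/
def diagonalAlgebra (V : Type u) [Quiver.{v} V] : Set (GraphHilbert V →L[ℂ] GraphHilbert V) :=
  vonNeumann (Set.range (vertexProj : V → _))

/-- The coefficient `p_w` of `L_w` in the Fourier expansion of `a`; for a vertex `v`
it is `p_v = ⟨ξ_v, a ξ_v⟩`. -/
def coeff (a : GraphHilbert V →L[ℂ] GraphHilbert V) (w : FreeSemigroupoid V) : ℂ :=
  ⟪basisVec w, a (basisVec (vertex w.rng))⟫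

/-- The coefficient of `L_w^*` in the Fourier expansion of `a`. -/
def coeffStar (a : GraphHilbert V →L[ℂ] GraphHilbert V) (w : FreeSemigroupoid V) : ℂ :=
  ⟪basisVec (vertex w.rng), a (basisVec w)⟫

/-- The support `𝔽⁺(G : a)`: the `w` for which `L_w` or `L_w^*` is a summand of `a`. -/
def support (a : GraphHilbert V →L[ℂ] GraphHilbert V) : Set (FreeSemigroupoid V) :=
  {w | coeff a w ≠ 0 ∨ coeffStar a w ≠ 0}

/-- `loop(G : a)`, the loops (finite paths of positive length with equal source and range) in the
support of `a`. -/
def loops (a : GraphHilbert V →L[ℂ] GraphHilbert V) : Set (FreeSemigroupoid V) :=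
  {l | l ∈ support a ∧ l ∈ FP V ∧ l.src = l.rng}

/-- `loop_v(G : a) = {l ∈ loop(G : a) : l = v l v}`, the loops in the support of `a` that are
based at `v`. -/
def loopsAt (a : GraphHilbert V →L[ℂ] GraphHilbert V) (x : V) : Set (FreeSemigroupoid V) :=
  {l | l ∈ loops a ∧ l.src = x ∧ l.rng = x}

theorem norm_coeff_vertex_le (a : GraphHilbert V →L[ℂ] GraphHilbert V) (x : V) :
    ‖coeff a (vertex x)‖ ≤ ‖a‖ := by
  classical
  have h1 : ∀ w : FreeSemigroupoid V, ‖basisVec w‖ = 1 := fun w => by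
    unfold basisVec
    rw [lp.norm_single (by simp)]
    simp
  refine (norm_inner_le_norm _ _).trans ?_
  rw [h1, one_mul]
  refine (a.le_opNorm _).trans ?_
  rw [h1, mul_one]

/-- The conditional expectation `E(a) = ∑_v p_v L_v` onto `D_G`. Since `L_v` is the projection onto
the span of the `ξ_w` with source `v`, this is the operator with
`E(a) ξ_w = p_{s(w)} ξ_w` for every `w`. -/
def condExp (a : GraphHilbert V →L[ℂ] GraphHilbert V) : GraphHilbert V →L[ℂ] GraphHilbert V :=
  weightedComp some (fun _ _ _ h h' => Option.some.inj (h.trans h'.symm))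
    (fun w => coeff a (vertex w.src)) ‖a‖ (fun w => norm_coeff_vertex_le a w.src)

/-- The diagonal compression `P_S(a) = ∑_{v ∈ S} L_v a L_v` by a finite set `S` of vertices. -/
def diagCompression (S : Finset V) (a : GraphHilbert V →L[ℂ] GraphHilbert V) :
    GraphHilbert V →L[ℂ] GraphHilbert V :=
  ∑ x ∈ S, vertexProj x * a * vertexProj x

end GraphW

end

/-!
The vertex projections `L_x` are mutually orthogonal and sum to `1`; an operator all of whose corners
`L_x T` vanish is `0` (`eq_zero_of_vertexProj_mul`). The diagonal compression `P_S(a)` and the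
elements of `D_G` commute with every `L_x`, so all the algebras in question split as direct sums over
the vertices, and the assertions can be tested on one corner at a time.

For `x ∉ S` the corner of `P_S(a)` at `x` is `0`, hence the von Neumann algebra generated by `P_S(a)`
and `D_G` is scalar there: `L_x T = ⟨ξ_x, T ξ_x⟩ L_x`
(`vertexProj_mul_eq_smul_of_mem_vonNeumann_diagCompression`). Since `V₁` and `V₂` are disjoint, every
vertex lies outside one of them. This gives everything.

* Freeness: a centred element of `B₁` vanishes on the corners outside `V₁`, and a centred element of
  `B₂` on those outside `V₂`, so their product is `0`
  (`mul_eq_zero_of_condExp_eq_zero`).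
* Cumulants: on each corner some entry of a mixed word is `0`. As `E` commutes with multiplication by
  `L_x`, every nested moment of the word vanishes on each corner (`mul_nestedMoment_eq_zero`), so that
  each term of the cumulant is `0`.
* If `x₁ ∈ B₂`, then `x₁` is scalar on each of the corners at the finitely many vertices of `V₁` and
  vanishes on the others, so it is a linear combination of vertex projections.
-/

noncomputable section

namespace GraphW

open FreeSemigroupoid

/-! ### Nested moments and multiplication by a central projection -/

section NestedMoment

open Classical

variable {A : Type*} [Ring A] {E : A → A} {P : A} {n : ℕ} (r : Setoid (Fin n)) {a : Fin n → A}

theorem commute_nestedMoment (hE : ∀ T, Commute P (E T)) (ha : ∀ j, Commute P (a j))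
    (acc : A) (l : List (Fin n)) (hacc : Commute P acc) :
    Commute P (nestedMoment E r a acc l) := by
  fun_induction nestedMoment E r a acc l with
  | case1 => exact Commute.one_right P
  | case2 acc i t h ih => exact (hE _).mul_right (ih (Commute.one_right P))
  | case3 acc i t h ih1 ih2 =>
    exact ih2 ((hacc.mul_right (ha i)).mul_right (ih1 (Commute.one_right P)))

/-- If `P` annihilates an entry, or the accumulated product (which is only used when the list of
remaining entries is nonempty), then it annihilates the nested moment. -/
theorem mul_nestedMoment_eq_zero (hE : ∀ T, Commute P (E T)) (hPE : ∀ T, P * T = 0 → P * E T = 0)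
    (ha : ∀ j, Commute P (a j)) (acc : A) (l : List (Fin n)) (hacc : Commute P acc)
    (h0 : (∃ j ∈ l, P * a j = 0) ∨ (l ≠ [] ∧ P * acc = 0)) :
    P * nestedMoment E r a acc l = 0 := by
  fun_induction nestedMoment E r a acc l with
  | case1 => simp at h0
  | case2 acc i t h ih =>
    have key : P * acc = 0 ∨ P * a i = 0 → P * (E (acc * a i) * nestedMoment E r a 1 t) = 0 := by
      intro h'
      have : P * (acc * a i) = 0 := by
        rcases h' with h' | h'
        · rw [← mul_assoc, h', zero_mul]
        · rw [← mul_assoc, hacc.eq, mul_assoc, h', mul_zero]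
      rw [← mul_assoc, hPE _ this, zero_mul]
    rcases h0 with ⟨j, hj, hj0⟩ | ⟨-, h0⟩
    · rcases List.mem_cons.1 hj with rfl | hj
      · exact key (Or.inr hj0)
      · rw [← mul_assoc, (hE _).eq, mul_assoc,
          ih (Commute.one_right P) (Or.inl ⟨j, hj, hj0⟩), mul_zero]
    · exact key (Or.inl h0)
  | case3 acc i t h ih1 ih2 =>
    have hgap := commute_nestedMoment r hE ha 1
      (t.takeWhile (fun j => decide (¬ r i j))) (Commute.one_right P)
    refine ih2 ((hacc.mul_right (ha i)).mul_right hgap) ?_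
    rcases h0 with ⟨j, hj, hj0⟩ | ⟨-, h0⟩
    · rcases List.mem_cons.1 hj with rfl | hj
      · refine Or.inr ⟨h, ?_⟩
        rw [← mul_assoc, ← mul_assoc, hacc.eq, mul_assoc acc, hj0, mul_zero, zero_mul]
      · rw [← List.takeWhile_append_dropWhile (p := fun j => decide (¬ r i j)) (l := t)] at hj
        rcases List.mem_append.1 hj with hj | hj
        · refine Or.inr ⟨h, ?_⟩
          rw [← mul_assoc, (hacc.mul_right (ha i)).eq, mul_assoc,
            ih1 (Commute.one_right P) (Or.inl ⟨j, hj, hj0⟩), mul_zero]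
        · exact Or.inl ⟨j, hj, hj0⟩
    · refine Or.inr ⟨h, ?_⟩
      rw [← mul_assoc, ← mul_assoc, h0, zero_mul, zero_mul]

end NestedMoment

/-! ### Identities that pass to the generated von Neumann algebra -/

section VonNeumann

open ContinuousLinearMapWOT

variable {H : Type*} [NormedAddCommGroup H] [InnerProductSpace ℂ H]

theorem continuous_ofCLM_mul (P : H →L[ℂ] H) :
    Continuous fun T : H →WOT[ℂ] H => ofCLM P * T :=
  continuous_postcomp (ofCLM P)

theorem continuous_mul_ofCLM (P : H →L[ℂ] H) :
    Continuous fun T : H →WOT[ℂ] H => T * ofCLM P :=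
  continuous_precomp (ofCLM P)

variable [CompleteSpace H] {S : Set (H →L[ℂ] H)}

theorem mem_vonNeumann_of_mem_adjoin {T : H →L[ℂ] H} (hT : T ∈ StarAlgebra.adjoin ℂ S) :
    T ∈ vonNeumann S :=
  subset_closure ⟨T, hT, rfl⟩

theorem eq_of_mem_vonNeumann {F G : (H →WOT[ℂ] H) → (H →WOT[ℂ] H)} (hF : Continuous F)
    (hG : Continuous G) (h : ∀ T ∈ StarAlgebra.adjoin ℂ S, F (ofCLM T) = G (ofCLM T))
    {T : H →L[ℂ] H} (hT : T ∈ vonNeumann S) : F (ofCLM T) = G (ofCLM T) :=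
  closure_minimal (t := {T | F T = G T}) (by rintro _ ⟨T, hT, rfl⟩; exact h T hT)
    (isClosed_eq hF hG) hT

theorem commute_of_mem_adjoin {P : H →L[ℂ] H} (hP : IsSelfAdjoint P) (hS : ∀ s ∈ S, Commute P s)
    {T : H →L[ℂ] H} (hT : T ∈ StarAlgebra.adjoin ℂ S) : Commute P T := by
  induction hT using StarAlgebra.adjoin_induction with
  | mem s hs => exact hS s hs
  | algebraMap c => exact (Algebra.commutes c P).symm
  | add _ _ _ _ h₁ h₂ => exact h₁.add_right h₂
  | mul _ _ _ _ h₁ h₂ => exact h₁.mul_right h₂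
  | star T _ h => rw [← hP.star_eq]; exact h.star_star

theorem commute_of_mem_vonNeumann {P : H →L[ℂ] H} (hP : IsSelfAdjoint P)
    (hS : ∀ s ∈ S, Commute P s) {T : H →L[ℂ] H} (hT : T ∈ vonNeumann S) : Commute P T :=
  ofCLM_injective <| eq_of_mem_vonNeumann (continuous_ofCLM_mul P) (continuous_mul_ofCLM P)
    (fun _ hT => congrArg ofCLM (commute_of_mem_adjoin hP hS hT).eq) hT

theorem exists_mul_eq_smul_of_mem_adjoin {P : H →L[ℂ] H} (hP : IsSelfAdjoint P)
    (hS : ∀ s ∈ S, Commute P s) (hS' : ∀ s ∈ S, ∃ c : ℂ, P * s = c • P) {T : H →L[ℂ] H}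
    (hT : T ∈ StarAlgebra.adjoin ℂ S) : ∃ c : ℂ, P * T = c • P := by
  induction hT using StarAlgebra.adjoin_induction with
  | mem s hs => exact hS' s hs
  | algebraMap c => exact ⟨c, by rw [← Algebra.commutes, ← Algebra.smul_def]⟩
  | add _ _ _ _ h₁ h₂ =>
    obtain ⟨c, hc⟩ := h₁
    obtain ⟨d, hd⟩ := h₂
    exact ⟨c + d, by rw [mul_add, hc, hd, add_smul]⟩
  | mul _ _ _ _ h₁ h₂ =>
    obtain ⟨c, hc⟩ := h₁
    obtain ⟨d, hd⟩ := h₂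
    exact ⟨c * d, by rw [← mul_assoc, hc, smul_mul_assoc, hd, smul_smul]⟩
  | star T hT h =>
    obtain ⟨c, hc⟩ := h
    refine ⟨star c, ?_⟩
    have := congrArg star ((commute_of_mem_adjoin hP hS hT).eq.symm.trans hc)
    rwa [star_mul, star_smul, hP.star_eq] at this

end VonNeumann

/-! ### The vertex projections -/

section Vertex

open Classical

universe u v

variable {V : Type u} [Quiver.{v} V] (x y : V) (S : Finset V)
  (T a : GraphHilbert V →L[ℂ] GraphHilbert V)

theorem inner_basisVec (w : FreeSemigroupoid V) (f : GraphHilbert V) : ⟪basisVec w, f⟫ = f w := by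
  unfold basisVec
  rw [lp.inner_single_left]
  simp

theorem mul?_vertex (w : FreeSemigroupoid V) :
    mul? (vertex x) w = if w.src = x then some w else none := by
  obtain ⟨s, t, p⟩ := w
  unfold mul? vertex
  by_cases h : s = x
  · subst h
    simp
  · simp [h]

theorem vertexProj_apply (f : GraphHilbert V) (w : FreeSemigroupoid V) :
    vertexProj x f w = if w.src = x then f w else 0 := by
  have h : annihilation (vertex x) (basisVec w) = if w.src = x then basisVec w else 0 := by
    ext u
    simp only [annihilation, weightedComp_apply, mul?_vertex, one_mul]
    by_cases hw : w.src = x <;> by_cases hu : u.src = x <;> simp only [hw, hu, if_true, if_false]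
    · rfl
    · have : u ≠ w := by rintro rfl; exact hu hw
      simp [basisVec, this]
    · have : u ≠ w := by rintro rfl; exact hw hu
      simp [basisVec, this]
    · rfl
  rw [← inner_basisVec, vertexProj, creation, ContinuousLinearMap.adjoint_inner_right, h]
  split_ifs
  · rw [inner_basisVec]
  · rw [inner_zero_left]

theorem isSelfAdjoint_vertexProj : IsSelfAdjoint (vertexProj x) := by
  rw [ContinuousLinearMap.isSelfAdjoint_iff']
  have : annihilation (vertex x) = vertexProj x := by
    ext f w
    rw [vertexProj_apply]
    simp only [annihilation, weightedComp_apply, mul?_vertex, one_mul]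
    split_ifs <;> rfl
  rw [← this]
  exact this.symm

theorem mul_apply_coord (f : GraphHilbert V) (w : FreeSemigroupoid V) : (T * a) f w = T (a f) w :=
  rfl

theorem smul_apply_coord (c : ℂ) (f : GraphHilbert V) (w : FreeSemigroupoid V) :
    (c • T) f w = c * T f w :=
  rfl

theorem vertexProj_mul_self : vertexProj x * vertexProj x = vertexProj x := by
  ext f w
  simp only [mul_apply_coord, vertexProj_apply]
  split_ifs <;> rfl

theorem vertexProj_mul_of_ne {x y : V} (h : x ≠ y) : vertexProj x * vertexProj y = 0 := by
  ext f w
  simp only [mul_apply_coord, vertexProj_apply]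
  split_ifs with h1 h2
  · exact absurd (h1.symm.trans h2) h
  · rfl
  · rfl

theorem commute_vertexProj : Commute (vertexProj x) (vertexProj y) := by
  by_cases h : x = y
  · rw [h]
  · rw [commute_iff_eq, vertexProj_mul_of_ne h, vertexProj_mul_of_ne (Ne.symm h)]

variable {T} in
theorem eq_zero_of_vertexProj_mul (h : ∀ x, vertexProj x * T = 0) : T = 0 := by
  ext f w
  have := congrArg (fun A : GraphHilbert V →L[ℂ] GraphHilbert V => A f w) (h w.src)
  simpa [vertexProj_apply] using this

theorem coeff_vertex : coeff T (vertex x) = T (basisVec (vertex x)) (vertex x) :=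
  inner_basisVec _ _

variable {x T} in
theorem coeff_vertex_eq_of_vertexProj_mul_eq_smul {c : ℂ} (h : vertexProj x * T = c • vertexProj x) :
    coeff T (vertex x) = c := by
  have := congrArg
    (fun A : GraphHilbert V →L[ℂ] GraphHilbert V => A (basisVec (vertex x)) (vertex x)) h
  simpa [vertexProj_apply, coeff_vertex, basisVec, show (vertex x).src = x from rfl] using this

theorem vertexProj_mul_eq_smul_of_mem_vonNeumann {x : V} {T : GraphHilbert V →L[ℂ] GraphHilbert V}
    {M : Set (GraphHilbert V →L[ℂ] GraphHilbert V)} (hM : ∀ s ∈ M, Commute (vertexProj x) s)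
    (hM' : ∀ s ∈ M, ∃ c : ℂ, vertexProj x * s = c • vertexProj x) (hT : T ∈ vonNeumann M) :
    vertexProj x * T = coeff T (vertex x) • vertexProj x := by
  -- In this form, with the scalar written as a matrix coefficient of `T`, the identity is
  -- continuous in the weak operator topology.
  refine ContinuousLinearMapWOT.ofCLM_injective <| eq_of_mem_vonNeumann
    (G := fun T => ⟪basisVec (vertex x), T (basisVec (vertex x))⟫ •
      ContinuousLinearMapWOT.ofCLM (vertexProj x))
    (continuous_ofCLM_mul (vertexProj x)) ?_ ?_ hT
  · exact (ContinuousLinearMapWOT.continuous_dual_apply (basisVec (vertex x))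
      (innerSL ℂ (basisVec (vertex x)))).smul continuous_const
  · intro T hT
    obtain ⟨c, hc⟩ := exists_mul_eq_smul_of_mem_adjoin (isSelfAdjoint_vertexProj x) hM hM' hT
    refine congrArg ContinuousLinearMapWOT.ofCLM (hc.trans ?_)
    rw [← coeff_vertex_eq_of_vertexProj_mul_eq_smul hc]
    rfl

/-! ### The conditional expectation -/

theorem condExp_apply (f : GraphHilbert V) (w : FreeSemigroupoid V) :
    condExp T f w = coeff T (vertex w.src) * f w := rfl

theorem commute_vertexProj_condExp : Commute (vertexProj x) (condExp T) := by
  ext f w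
  simp only [mul_apply_coord, vertexProj_apply, condExp_apply, mul_ite, mul_zero]

theorem vertexProj_mul_condExp : vertexProj x * condExp T = coeff T (vertex x) • vertexProj x := by
  ext f w
  simp only [mul_apply_coord, smul_apply_coord, vertexProj_apply, condExp_apply]
  split_ifs with h
  · rw [h]
  · rw [mul_zero]

variable {x T} in
theorem coeff_vertex_eq_zero_of_vertexProj_mul (h : vertexProj x * T = 0) :
    coeff T (vertex x) = 0 :=
  coeff_vertex_eq_of_vertexProj_mul_eq_smul (h.trans (zero_smul ℂ _).symm)

variable {T} in
theorem coeff_vertex_eq_zero_of_condExp (h : condExp T = 0) : coeff T (vertex x) = 0 := by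
  have := condExp_apply T (basisVec (vertex x)) (vertex x)
  simpa [h, basisVec, show (vertex x).src = x from rfl] using this.symm

theorem condExp_zero : condExp (0 : GraphHilbert V →L[ℂ] GraphHilbert V) = 0 := by
  ext f w
  simp [condExp_apply, coeff]

/-! ### The diagonal subalgebra and the diagonal compressions -/

theorem commute_vertexProj_of_mem_diagonalAlgebra {d : GraphHilbert V →L[ℂ] GraphHilbert V}
    (hd : d ∈ diagonalAlgebra V) : Commute (vertexProj x) d :=
  commute_of_mem_vonNeumann (isSelfAdjoint_vertexProj x)
    (by rintro _ ⟨y, rfl⟩; exact commute_vertexProj x y) hd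

theorem exists_vertexProj_mul_of_mem_diagonalAlgebra {d : GraphHilbert V →L[ℂ] GraphHilbert V}
    (hd : d ∈ diagonalAlgebra V) : ∃ c : ℂ, vertexProj x * d = c • vertexProj x := by
  refine ⟨_, vertexProj_mul_eq_smul_of_mem_vonNeumann ?_ ?_ hd⟩
  · rintro _ ⟨y, rfl⟩
    exact commute_vertexProj x y
  · rintro _ ⟨y, rfl⟩
    by_cases h : x = y
    · exact ⟨1, by rw [← h, vertexProj_mul_self, one_smul]⟩
    · exact ⟨0, by rw [vertexProj_mul_of_ne h, zero_smul]⟩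

theorem commute_vertexProj_diagCompression : Commute (vertexProj x) (diagCompression S a) := by
  refine Commute.sum_right _ _ _ fun y _ => ?_
  by_cases h : x = y
  · subst h
    rw [commute_iff_eq, mul_assoc _ (vertexProj x) (vertexProj x), vertexProj_mul_self,
      ← mul_assoc, ← mul_assoc, vertexProj_mul_self]
  · rw [commute_iff_eq, mul_assoc _ _ (vertexProj x), vertexProj_mul_of_ne (Ne.symm h),
      ← mul_assoc, ← mul_assoc, vertexProj_mul_of_ne h]
    simp

variable {x S} in
theorem vertexProj_mul_diagCompression_of_notMem (hx : x ∉ S) :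
    vertexProj x * diagCompression S a = 0 := by
  rw [diagCompression, Finset.mul_sum]
  refine Finset.sum_eq_zero fun y hy => ?_
  rw [← mul_assoc, ← mul_assoc, vertexProj_mul_of_ne (by rintro rfl; exact hx hy), zero_mul,
    zero_mul]

variable {S T a}

theorem commute_vertexProj_of_mem_vonNeumann_diagCompression
    (hT : T ∈ vonNeumann ({diagCompression S a} ∪ diagonalAlgebra V)) :
    Commute (vertexProj x) T := by
  refine commute_of_mem_vonNeumann (isSelfAdjoint_vertexProj x) ?_ hT
  rintro s (rfl | hs)
  · exact commute_vertexProj_diagCompression x S a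
  · exact commute_vertexProj_of_mem_diagonalAlgebra x hs

variable {x} in
theorem vertexProj_mul_eq_smul_of_mem_vonNeumann_diagCompression (hx : x ∉ S)
    (hT : T ∈ vonNeumann ({diagCompression S a} ∪ diagonalAlgebra V)) :
    vertexProj x * T = coeff T (vertex x) • vertexProj x := by
  refine vertexProj_mul_eq_smul_of_mem_vonNeumann ?_ ?_ hT
  · rintro s (rfl | hs)
    · exact commute_vertexProj_diagCompression x S a
    · exact commute_vertexProj_of_mem_diagonalAlgebra x hs
  · rintro s (rfl | hs)
    · exact ⟨0, by rw [vertexProj_mul_diagCompression_of_notMem a hx, zero_smul]⟩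
    · exact exists_vertexProj_mul_of_mem_diagonalAlgebra x hs

/-! ### Freeness, cumulants and intersection for disjoint sets of vertices -/

variable {S₁ S₂ : Finset V} {b c : GraphHilbert V →L[ℂ] GraphHilbert V}

theorem mul_eq_zero_of_condExp_eq_zero (hS : Disjoint S₁ S₂)
    (hb : b ∈ vonNeumann ({diagCompression S₁ a} ∪ diagonalAlgebra V)) (hb0 : condExp b = 0)
    (hc : c ∈ vonNeumann ({diagCompression S₂ a} ∪ diagonalAlgebra V)) (hc0 : condExp c = 0) :
    b * c = 0 := by
  refine eq_zero_of_vertexProj_mul fun x => ?_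
  by_cases hx : x ∈ S₁
  · rw [← mul_assoc, (commute_vertexProj_of_mem_vonNeumann_diagCompression x hb).eq, mul_assoc,
      vertexProj_mul_eq_smul_of_mem_vonNeumann_diagCompression (Finset.disjoint_left.1 hS hx) hc,
      coeff_vertex_eq_zero_of_condExp x hc0, zero_smul, mul_zero]
  · rw [← mul_assoc, vertexProj_mul_eq_smul_of_mem_vonNeumann_diagCompression hx hb,
      coeff_vertex_eq_zero_of_condExp x hb0, zero_smul, zero_mul]

theorem freeAlgebras_diagCompression (hS : Disjoint S₁ S₂) :
    FreeAlgebras condExp ![vonNeumann ({diagCompression S₁ a} ∪ diagonalAlgebra V),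
      vonNeumann ({diagCompression S₂ a} ∪ diagonalAlgebra V)] := by
  rintro (_ | n) i c hi hc
  · simpa using (hc 0).2
  · have h01 : c 0 * c 1 = 0 := by
      have hne : i 0 ≠ i 1 := hi 0
      obtain ⟨hb, hb0⟩ := hc 0
      obtain ⟨hb', hb0'⟩ := hc 1
      generalize i 0 = p at *
      generalize i 1 = q at *
      fin_cases p <;> fin_cases q
      · exact absurd rfl hne
      · exact mul_eq_zero_of_condExp_eq_zero hS hb hb0 hb' hb0'
      · exact mul_eq_zero_of_condExp_eq_zero hS.symm hb hb0 hb' hb0'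
      · exact absurd rfl hne
    rw [List.ofFn_succ, List.ofFn_succ, List.prod_cons, List.prod_cons, ← mul_assoc,
      show c (Fin.succ 0) = c 1 from rfl, h01, zero_mul, condExp_zero]

theorem mixedCumulantsVanish_diagCompression (hS : Disjoint S₁ S₂) :
    MixedCumulantsVanish condExp (diagonalAlgebra V)
      ![diagCompression S₁ a, diagCompression S₂ a] := by
  intro n i ε d hd hij
  have hcomm (x : V) (p : Fin 2) :
      Commute (vertexProj x) (![diagCompression S₁ a, diagCompression S₂ a] p) := by
    fin_cases p <;> exact commute_vertexProj_diagCompression x _ a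
  have hentry (x : V) (j : Fin n) (y : GraphHilbert V →L[ℂ] GraphHilbert V)
      (hy : Commute (vertexProj x) y) :
      Commute (vertexProj x) (if ε j then star y else y) := by
    split_ifs
    · rw [← (isSelfAdjoint_vertexProj x).star_eq]
      exact hy.star_star
    · exact hy
  refine Finset.sum_eq_zero fun π _ => ?_
  convert smul_zero _
  refine eq_zero_of_vertexProj_mul fun x => ?_
  refine mul_nestedMoment_eq_zero π.1 (fun T => commute_vertexProj_condExp x T) (fun T hT => ?_)
    (fun j => (commute_vertexProj_of_mem_diagonalAlgebra x (hd j)).mul_right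
      (hentry x j _ (hcomm x _))) 1 _ (Commute.one_right _) (Or.inl ?_)
  · rw [vertexProj_mul_condExp, coeff_vertex_eq_zero_of_vertexProj_mul hT, zero_smul]
  -- Both indices occur in the word, and `x` lies outside one of the two sets of vertices.
  have hex : ∃ j, vertexProj x * ![diagCompression S₁ a, diagCompression S₂ a] (i j) = 0 := by
    have hmem (p : Fin 2) : ∃ j, i j = p := by
      obtain ⟨j, k, hjk⟩ := hij
      by_cases hj : i j = p
      · exact ⟨j, hj⟩
      · exact ⟨k, by omega⟩
    by_cases hx : x ∈ S₁
    · obtain ⟨j, hj⟩ := hmem 1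
      refine ⟨j, ?_⟩
      rw [hj]
      exact vertexProj_mul_diagCompression_of_notMem a (Finset.disjoint_left.1 hS hx)
    · obtain ⟨j, hj⟩ := hmem 0
      refine ⟨j, ?_⟩
      rw [hj]
      exact vertexProj_mul_diagCompression_of_notMem a hx
  obtain ⟨j, hj⟩ := hex
  refine ⟨j, List.mem_finRange j, ?_⟩
  have hstar : vertexProj x * (if ε j then
      star (![diagCompression S₁ a, diagCompression S₂ a] (i j))
      else ![diagCompression S₁ a, diagCompression S₂ a] (i j)) = 0 := by
    split_ifs
    · have := congrArg star ((hcomm x (i j)).eq.symm.trans hj)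
      rwa [star_mul, (isSelfAdjoint_vertexProj x).star_eq, star_zero] at this
    · exact hj
  rw [← mul_assoc, (commute_vertexProj_of_mem_diagonalAlgebra x (hd j)).eq, mul_assoc, hstar,
    mul_zero]

theorem diagCompression_mem_diagonalAlgebra (hS : Disjoint S₁ S₂)
    (h : diagCompression S₁ a ∈ vonNeumann ({diagCompression S₂ a} ∪ diagonalAlgebra V)) :
    diagCompression S₁ a ∈ diagonalAlgebra V := by
  have hsum : diagCompression S₁ a =
      ∑ y ∈ S₁, coeff (diagCompression S₁ a) (vertex y) • vertexProj y := by
    refine sub_eq_zero.1 (eq_zero_of_vertexProj_mul fun x => ?_)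
    rw [mul_sub, Finset.mul_sum, sub_eq_zero]
    by_cases hx : x ∈ S₁
    · rw [Finset.sum_eq_single_of_mem x hx, mul_smul_comm, vertexProj_mul_self]
      · exact vertexProj_mul_eq_smul_of_mem_vonNeumann_diagCompression
          (Finset.disjoint_left.1 hS hx) h
      · intro y _ hy
        rw [mul_smul_comm, vertexProj_mul_of_ne hy.symm, smul_zero]
    · rw [vertexProj_mul_diagCompression_of_notMem a hx, Finset.sum_eq_zero]
      intro y hy
      rw [mul_smul_comm, vertexProj_mul_of_ne (by rintro rfl; exact hx hy), smul_zero]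
  rw [hsum]
  exact mem_vonNeumann_of_mem_adjoin <| sum_mem fun y _ =>
    SMulMemClass.smul_mem _ (StarAlgebra.subset_adjoin ℂ _ ⟨y, rfl⟩)

end Vertex

end GraphW

end

theorem mainTheorem3 {V : Type*} [Quiver V] [Countable V] [∀ x y : V, Countable (x ⟶ y)]
    (a : GraphW.GraphHilbert V →L[ℂ] GraphW.GraphHilbert V) (ha : a ∈ GraphW.graphAlgebra V)
    (V₁ V₂ : Finset V) (hV : Disjoint V₁ V₂)
    (hloop : ∀ v₁ ∈ V₁, ∀ v₂ ∈ V₂, GraphW.loopsAt a v₁ ∩ GraphW.loopsAt a v₂ = ∅) :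
    GraphW.FreeAlgebras GraphW.condExp
        ![GraphW.vonNeumann ({GraphW.diagCompression V₁ a} ∪ GraphW.diagonalAlgebra V),
          GraphW.vonNeumann ({GraphW.diagCompression V₂ a} ∪ GraphW.diagonalAlgebra V)] ∧
      GraphW.MixedCumulantsVanish GraphW.condExp (GraphW.diagonalAlgebra V)
        ![GraphW.diagCompression V₁ a, GraphW.diagCompression V₂ a] ∧
      (GraphW.diagCompression V₁ a ∈
          GraphW.vonNeumann ({GraphW.diagCompression V₂ a} ∪ GraphW.diagonalAlgebra V) →
        GraphW.diagCompression V₁ a ∈ GraphW.diagonalAlgebra V) ∧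
      (GraphW.diagCompression V₂ a ∈
          GraphW.vonNeumann ({GraphW.diagCompression V₁ a} ∪ GraphW.diagonalAlgebra V) →
        GraphW.diagCompression V₂ a ∈ GraphW.diagonalAlgebra V) :=
  ⟨GraphW.freeAlgebras_diagCompression hV, GraphW.mixedCumulantsVanish_diagCompression hV,
    GraphW.diagCompression_mem_diagonalAlgebra hV,
    GraphW.diagCompression_mem_diagonalAlgebra hV.symm⟩
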